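/- Let $m,n,K$ be integers with $1\le K<N:=\min(m,n)$, let $\rho>0$, and let $\|\cdot\|$ be the Frobenius norm on the complex $m\times n$ matrices, with real inner product $\langle A,B\rangle=\operatorname{Re}\operatorname{tr}(A^*B)$. Let $F=U\Sigma_\phi V^*$ be a singular value decomposition, where $U,V$ have $N$ orthonormal columns and $\Sigma_\phi$ is diagonal with entries $\phi_1\ge\dots\ge\phi_N\ge 0$. Put $\mathcal I(A)=\|A-F\|^2$ if $\operatorname{rank}A\le K$ and $\mathcal I(A)=\infty$ otherwise, and let $\mathcal I^{**}$ be the Fenchel biconjugate of $\mathcal I$, where $f^*(B)=\sup_A\,(\langle A,B\rangle-f(A))$. For $s\in\mathbb R$ and integers $k_1,k_2$ let $$\alpha_j=\begin{cases}\phi_j,& j<k_1,\\ \phi_j-\frac{s-\phi_j}{\rho},& k_1\le j\le k_2,\\ 0,&\text{otherwise}\end{cases}\qquad(1\le j\le N).$$ Say that $(s,k_1,k_2)$ *describes the proximal point* if $1\le k_1\le K\le k_2\le N$, $s>\phi_{k_2}$, and $U\Sigma_\alpha V^*$ is the unique minimizer over $A$ of $\mathcal I^{**}(A)+\rho\|A-F\|^2$.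 Let $$g(s)=\sum_{j=1}^K\bigl(\max(\phi_j,s)-\phi_j\bigr)^2+(1+\rho)\sum_{j=K+1}^N\Bigl(\min\bigl(\phi_j,\tfrac{s}{1+\rho}\bigr)-\phi_j\Bigr)^2,$$ and let $J$ be the closed interval with end points $\phi_K$ and $(1+\rho)\phi_{K+1}$ (in either order). Then: 1. $g$ has a minimizer over $J$, and it is unique if $\phi_K<(1+\rho)\phi_{K+1}$. 2. Let $s$ be a minimizer of $g$ over $J$, let $k_1$ be the smallest index in $\{1,\dots,N\}$ with $\phi_{k_1}<s$ ($k_1=N+1$ if there is none), and let $k_2$ be the last index in $\{1,\dots,N\}$ with $\phi_{k_2}>\frac{s}{1+\rho}$ ($k_2=0$ if there is none). Then $U\Sigma_\alpha V^*$ is the unique minimizer of $\mathcal I^{**}(A)+\rho\|A-F\|^2$. If $\phi_K<(1+\rho)\phi_{K+1}$, then indices with $\phi_{k_1}<s$ and with $\phi_{k_2}>\frac s{1+\rho}$ exist, and $(s,k_1,k_2)$ describes the proximal point. 3. Conversely, if $(s,k_1,k_2)$ describes the proximal point for some $k_1,k_2$, then $s$ is a minimizer of $g$ over $J$. -/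

import Mathlib

attribute [local instance] Matrix.frobeniusNormedAddCommGroup

noncomputable section

namespace FixedRank

/-- Complex `m × n` matrices; the norm in use is the Frobenius norm. -/
abbrev Mat (m n : ℕ) : Type := Matrix (Fin m) (Fin n) ℂ

/-- The real Frobenius inner product `Re tr (Aᴴ B)`. -/
def frobInner {m n : ℕ} (A B : Mat m n) : ℝ := (A.conjTranspose * B).trace.re

/-- The Fenchel conjugate `f*(B) = sup_A ⟨A, B⟩ - f(A)` of an extended-real-valued function. -/
def fenchel {m n : ℕ} (f : Mat m n → EReal) (B : Mat m n) : EReal :=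
  ⨆ A : Mat m n, (frobInner A B : EReal) - f A

open Classical in
/-- `R_K(A) = 0` if `rank A ≤ K`, and `∞` otherwise. -/
def rankIndicator {m n : ℕ} (K : ℕ) (A : Mat m n) : EReal :=
  if A.rank ≤ K then 0 else ⊤

/-- `I(A) = R_K(A) + ‖A - F‖²`. -/
def fixedRankFun {m n : ℕ} (K : ℕ) (F A : Mat m n) : EReal :=
  rankIndicator K A + ((‖A - F‖ ^ 2 : ℝ) : EReal)

/-- `I** = (I*)*`, the Fenchel biconjugate of `I`. -/
def fixedRankEnvelope {m n : ℕ} (K : ℕ) (F : Mat m n) : Mat m n → EReal :=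
  fenchel (fenchel (fixedRankFun K F))

/-- The set of all minimizers over `A` of `I**(A) + ρ ‖A - F‖²`. -/
def proxSolutions {m n : ℕ} (K : ℕ) (ρ : ℝ) (F : Mat m n) : Set (Mat m n) :=
  {A | IsMinOn (fun B : Mat m n =>
    fixedRankEnvelope K F B + ((ρ * ‖B - F‖ ^ 2 : ℝ) : EReal)) Set.univ A}

/-- `U Σ_α Vᴴ`, where `Σ_α` is the diagonal matrix with entries `α 1, …, α N`, `N = min m n`.
Sequences are indexed from `1`; only the values at `1, …, N` matter. -/
def assemble {m n : ℕ} (U : Mat m (min m n)) (α : ℕ → ℝ) (V : Mat n (min m n)) : Mat m n :=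
  U * Matrix.diagonal (fun i : Fin (min m n) => ((α (i.val + 1) : ℝ) : ℂ)) * V.conjTranspose

/-- `F = U Σ_φ Vᴴ` is a singular value decomposition: `U`, `V` have orthonormal columns, and
`φ 1 ≥ φ 2 ≥ … ≥ φ N ≥ 0`. -/
structure IsSVD {m n : ℕ} (F : Mat m n) (U : Mat m (min m n)) (φ : ℕ → ℝ)
    (V : Mat n (min m n)) : Prop where
  left_orthonormal : U.conjTranspose * U = 1
  right_orthonormal : V.conjTranspose * V = 1
  antitone : AntitoneOn φ (Set.Icc 1 (min m n))
  nonneg : ∀ j ∈ Set.Icc 1 (min m n), 0 ≤ φ j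
  eq : F = assemble U φ V

/-- `α_j = φ_j` for `j < k₁`, `α_j = φ_j - (s - φ_j) / ρ` for `k₁ ≤ j ≤ k₂`, and `α_j = 0` for
all other `j`. -/
def proxValues (φ : ℕ → ℝ) (ρ s : ℝ) (k₁ k₂ : ℕ) (j : ℕ) : ℝ :=
  if j < k₁ then φ j else if j ≤ k₂ then φ j - (s - φ j) / ρ else 0

/-- `s`, `k₁`, `k₂` describe the proximal point: `k₁ ≤ K ≤ k₂`, `s > φ_{k₂}`, and the problem of
minimizing `I**(A) + ρ ‖A - F‖²` has the unique solution `U Σ_α Vᴴ` with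
`α = proxValues φ ρ s k₁ k₂`. -/
def IsProxParam {m n : ℕ} (K : ℕ) (ρ : ℝ) (F : Mat m n) (U : Mat m (min m n)) (φ : ℕ → ℝ)
    (V : Mat n (min m n)) (s : ℝ) (k₁ k₂ : ℕ) : Prop :=
  1 ≤ k₁ ∧ k₁ ≤ K ∧ K ≤ k₂ ∧ k₂ ≤ min m n ∧ φ k₂ < s ∧
    proxSolutions K ρ F = {assemble U (proxValues φ ρ s k₁ k₂) V}

/-- The function of `s` to be minimized. -/
def sObjective (N K : ℕ) (ρ : ℝ) (φ : ℕ → ℝ) (s : ℝ) : ℝ :=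
  ∑ j ∈ Finset.Icc 1 K, (max (φ j) s - φ j) ^ 2 +
    (1 + ρ) * ∑ j ∈ Finset.Icc (K + 1) N, (min (φ j) (s / (1 + ρ)) - φ j) ^ 2

/-- `s` minimizes the objective over the closed interval with end points `φ_K` and
`(1 + ρ) φ_{K+1}` (in either order). -/
def IsOptimalS (N K : ℕ) (ρ : ℝ) (φ : ℕ → ℝ) (s : ℝ) : Prop :=
  s ∈ Set.uIcc (φ K) ((1 + ρ) * φ (K + 1)) ∧
    IsMinOn (sObjective N K ρ φ) (Set.uIcc (φ K) ((1 + ρ) * φ (K + 1))) s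

/-- `k` is the smallest index in `1, …, N` with `φ_k < s`; `k = N + 1` if there is none. -/
def IsFirstBelow (N : ℕ) (φ : ℕ → ℝ) (s : ℝ) (k : ℕ) : Prop :=
  IsLeast (insert (N + 1) {j | j ∈ Set.Icc 1 N ∧ φ j < s}) k

/-- `k` is the last index in `1, …, N` with `φ_k > t`; `k = 0` if there is none. -/
def IsLastAbove (N : ℕ) (φ : ℕ → ℝ) (t : ℝ) (k : ℕ) : Prop :=
  IsGreatest (insert 0 {j | j ∈ Set.Icc 1 N ∧ t < φ j}) k

end FixedRank

end

/-!
The proof is by convex duality, and only the values of conjugates that the argument needs are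
computed.

Completing the square, the conjugate of `I` at `B = 2 (Y - F)` is the supremum over
`rank A ≤ K` of `2 ⟨A, Y⟩ - ‖A‖² - ‖F‖²`. If `Y = U Σ_y Vᴴ`, with the first `K` entries of `y` at
least `t ≥ 0` and the others in `[0, t]`, it is at most `∑_{j ≤ K} y_j² - ‖F‖²`
(`two_mul_frobInner_sub_norm_sq_le`). This gives an affine minorant of `I**`; adding
`ρ ‖A - F‖²` to it produces a quadratic whose vertex is `A₀ = F - (Y - F) / ρ`. Hence `A₀` is
the unique minimizer as soon as the minorant is exact at `A₀` (`proxSolutions_eq_singleton`).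

Exactness holds if `A₀ = U Σ_{θ y} Vᴴ` with weights `θ_j ∈ [0, 1]` that add up to `K` and satisfy
`∑ θ_j y_j² = ∑_{j ≤ K} y_j²` (`proxSolutions_eq_of_weights`): the conjugate at any other matrix is
bounded below by testing it on the truncations of `Y` to `K` diagonal positions, and the best
truncation scores at least as much as the fractional choice `θ`
(`exists_card_eq_sum_weights_le`).

For an optimal `s`, such a pair is given by `y_j = max(φ_j, s)` for `j ≤ K` and
`y_j = min((1 + ρ) φ_j, s)` for `j > K`. Then `A₀` has exactly the singular values `proxValues`, and
the weights add up to `K` because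
`∑_{j ≤ K} (max(φ_j, s) - φ_j) + ∑_{j > K} (min(φ_j, s / (1 + ρ)) - φ_j)` vanishes
(`sum_dualWeights`). This expression is half of the derivative of the scalar objective. If
`φ_K < (1 + ρ) φ_{K+1}`, it changes sign on the interval, and strong convexity of the objective
there identifies its zero with the unique minimizer (`isOptimalS_iff_of_lt`). Otherwise it
vanishes on the whole interval, as does the objective (`isOptimalS_iff_of_ge`).

For the converse, uniqueness of the proximal point determines `y_K`, and `y_K = s` whenever
`k₁ ≤ K ≤ k₂` (`IsProxParam.isOptimalS`).
-/

namespace FixedRank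

open Matrix Finset

/-! ### The Frobenius inner product -/

section FrobInner

variable {m n r : ℕ}

lemma frobInner_add_right (A B C : Mat m n) :
    frobInner A (B + C) = frobInner A B + frobInner A C := by
  simp [frobInner, Matrix.mul_add]

lemma frobInner_sub_left (A B C : Mat m n) :
    frobInner (A - B) C = frobInner A C - frobInner B C := by
  simp [frobInner, Matrix.sub_mul]

lemma frobInner_sub_right (A B C : Mat m n) :
    frobInner A (B - C) = frobInner A B - frobInner A C := by
  simp [frobInner, Matrix.mul_sub]

lemma frobInner_smul_left (c : ℝ) (A B : Mat m n) :
    frobInner (c • A) B = c * frobInner A B := by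
  simp [frobInner, Matrix.conjTranspose_smul]

lemma frobInner_smul_right (c : ℝ) (A B : Mat m n) :
    frobInner A (c • B) = c * frobInner A B := by
  simp [frobInner]

lemma frobInner_comm (A B : Mat m n) : frobInner A B = frobInner B A := by
  unfold frobInner
  rw [← Complex.conj_re (Bᴴ * A).trace, ← Complex.star_def, ← Matrix.trace_conjTranspose,
    Matrix.conjTranspose_mul, Matrix.conjTranspose_conjTranspose]

lemma frobInner_eq_sum (A B : Mat m n) :
    frobInner A B = ∑ i, ∑ j, (star (A i j) * B i j).re := by
  rw [Finset.sum_comm]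
  simp [frobInner, Matrix.trace, Matrix.mul_apply]

lemma frobInner_self_eq_sum (A : Mat m n) : frobInner A A = ∑ i, ∑ j, ‖A i j‖ ^ 2 := by
  rw [frobInner_eq_sum]
  refine Finset.sum_congr rfl fun i _ => Finset.sum_congr rfl fun j _ => ?_
  rw [Complex.star_def, ← Complex.normSq_eq_conj_mul_self, Complex.ofReal_re,
    Complex.normSq_eq_norm_sq]

lemma frobInner_self (A : Mat m n) : frobInner A A = ‖A‖ ^ 2 := by
  rw [frobInner_self_eq_sum, Matrix.frobenius_norm_def, ← Real.sqrt_eq_rpow, Real.sq_sqrt]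
  · simp
  · positivity

lemma frobInner_mul_left (Q : Mat m r) (C : Mat r n) (Y : Mat m n) :
    frobInner (Q * C) Y = frobInner C (Qᴴ * Y) := by
  simp [frobInner, Matrix.conjTranspose_mul, Matrix.mul_assoc]

lemma frobInner_mul_conjTranspose_right (A : Mat m n) (X : Mat m r) (V : Mat n r) :
    frobInner A (X * Vᴴ) = frobInner (A * V) X := by
  unfold frobInner
  rw [Matrix.conjTranspose_mul, ← Matrix.mul_assoc, Matrix.trace_mul_comm, Matrix.mul_assoc]

lemma norm_sub_sq_eq (A B : Mat m n) :
    ‖A - B‖ ^ 2 = ‖A‖ ^ 2 - 2 * frobInner A B + ‖B‖ ^ 2 := by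
  rw [← frobInner_self, ← frobInner_self, ← frobInner_self, frobInner_sub_left,
    frobInner_sub_right, frobInner_sub_right, frobInner_comm B A]
  ring

lemma norm_mul_sq_of_orthonormal {Q : Mat m r} (hQ : Qᴴ * Q = 1) (C : Mat r n) :
    ‖Q * C‖ ^ 2 = ‖C‖ ^ 2 := by
  rw [← frobInner_self, frobInner_mul_left, ← Matrix.mul_assoc, hQ, Matrix.one_mul,
    frobInner_self]

lemma norm_mul_conjTranspose_sq_of_orthonormal {V : Mat n r} (hV : Vᴴ * V = 1) (X : Mat m r) :
    ‖X * Vᴴ‖ ^ 2 = ‖X‖ ^ 2 := by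
  rw [← frobInner_self, frobInner_mul_conjTranspose_right, Matrix.mul_assoc, hV,
    Matrix.mul_one, frobInner_self]

/-- Bessel's inequality for the orthonormal columns of `Q`. -/
lemma norm_conjTranspose_mul_sq_le {Q : Mat m r} (hQ : Qᴴ * Q = 1) (X : Mat m n) :
    ‖Qᴴ * X‖ ^ 2 ≤ ‖X‖ ^ 2 := by
  have h := norm_sub_sq_eq X (Q * (Qᴴ * X))
  rw [norm_mul_sq_of_orthonormal hQ, frobInner_comm, frobInner_mul_left, frobInner_self] at h
  nlinarith [sq_nonneg ‖X - Q * (Qᴴ * X)‖]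

lemma sum_norm_sq_col_conjTranspose_mul_le {Q : Mat m r} (hQ : Qᴴ * Q = 1) {U : Mat m n}
    (hU : Uᴴ * U = 1) (j : Fin n) : ∑ i, ‖(Qᴴ * U) i j‖ ^ 2 ≤ 1 := by
  have h := norm_conjTranspose_mul_sq_le hQ (Matrix.of fun (i : Fin m) (_ : Fin 1) => U i j)
  have hcol : (Uᴴ * U) j j = 1 := by rw [hU, Matrix.one_apply_eq]
  rw [← frobInner_self, ← frobInner_self, frobInner_self_eq_sum] at h
  have h1 : frobInner (Matrix.of fun (i : Fin m) (_ : Fin 1) => U i j)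
      (Matrix.of fun (i : Fin m) (_ : Fin 1) => U i j) = 1 := by
    rw [← Complex.one_re, ← hcol]
    simp [frobInner, Matrix.trace, Matrix.mul_apply]
  rw [h1] at h
  simpa [Matrix.mul_apply] using h

end FrobInner

/-! ### Matrices that share a pair of orthonormal frames -/

section Assemble

variable {m n r : ℕ}

/-- `∑_{i : Fin N} f (i + 1) = ∑_{j = 1}^N f j`. -/
lemma sum_fin_succ_eq_sum_Icc (N : ℕ) (f : ℕ → ℝ) :
    ∑ i : Fin N, f (i.val + 1) = ∑ j ∈ Finset.Icc 1 N, f j := by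
  rw [Fin.sum_univ_eq_sum_range (fun i => f (i + 1)) N, Finset.range_eq_Ico,
    Finset.sum_Ico_add' f 0 N 1]
  rfl

lemma conjTranspose_mul_assemble_mul {U : Mat m (min m n)} {V : Mat n (min m n)}
    (hU : Uᴴ * U = 1) (hV : Vᴴ * V = 1) (a : ℕ → ℝ) :
    Uᴴ * assemble U a V * V =
      Matrix.diagonal (fun i : Fin (min m n) => ((a (i.val + 1) : ℝ) : ℂ)) := by
  unfold assemble
  rw [Matrix.mul_assoc, Matrix.mul_assoc, hV, Matrix.mul_one, ← Matrix.mul_assoc, hU,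
    Matrix.one_mul]

lemma frobInner_assemble_left (U : Mat m (min m n)) (V : Mat n (min m n)) (a : ℕ → ℝ)
    (Y : Mat m n) :
    frobInner (assemble U a V) Y =
      ∑ i : Fin (min m n), a (i.val + 1) * ((Uᴴ * Y * V) i i).re := by
  rw [frobInner_comm, assemble, frobInner_mul_conjTranspose_right, frobInner_comm,
    frobInner_mul_left]
  simp [frobInner, Matrix.trace, Matrix.mul_assoc, Matrix.diagonal_conjTranspose,
    Matrix.diagonal_mul]

lemma frobInner_assemble_assemble {U : Mat m (min m n)} {V : Mat n (min m n)}
    (hU : Uᴴ * U = 1) (hV : Vᴴ * V = 1) (a b : ℕ → ℝ) :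
    frobInner (assemble U a V) (assemble U b V) = ∑ j ∈ Finset.Icc 1 (min m n), a j * b j := by
  rw [frobInner_assemble_left, conjTranspose_mul_assemble_mul hU hV,
    ← sum_fin_succ_eq_sum_Icc _ fun j => a j * b j]
  simp

lemma assemble_sub (U : Mat m (min m n)) (V : Mat n (min m n)) (a b : ℕ → ℝ) :
    assemble U a V - assemble U b V = assemble U (fun j => a j - b j) V := by
  unfold assemble
  rw [← Matrix.sub_mul, ← Matrix.mul_sub, Matrix.diagonal_sub]
  simp

lemma smul_assemble (U : Mat m (min m n)) (V : Mat n (min m n)) (c : ℝ) (a : ℕ → ℝ) :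
    c • assemble U a V = assemble U (fun j => c * a j) V := by
  unfold assemble
  rw [← Matrix.smul_mul, ← Matrix.mul_smul, ← Matrix.diagonal_smul]
  congr 3
  ext i
  simp

lemma assemble_congr (U : Mat m (min m n)) (V : Mat n (min m n)) {a b : ℕ → ℝ}
    (h : ∀ j ∈ Set.Icc 1 (min m n), a j = b j) : assemble U a V = assemble U b V := by
  unfold assemble
  congr 3
  ext i
  rw [h _ ⟨Nat.le_add_left 1 i, i.isLt⟩]

lemma assemble_injOn {U : Mat m (min m n)} {V : Mat n (min m n)}
    (hU : Uᴴ * U = 1) (hV : Vᴴ * V = 1) {a b : ℕ → ℝ} (h : assemble U a V = assemble U b V)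
    {j : ℕ} (hj : j ∈ Set.Icc 1 (min m n)) : a j = b j := by
  have h1 := conjTranspose_mul_assemble_mul hU hV a
  rw [h, conjTranspose_mul_assemble_mul hU hV b] at h1
  obtain ⟨i, rfl⟩ : ∃ i, j = i + 1 := ⟨j - 1, by have := hj.1; omega⟩
  have h2 := congrFun (Matrix.diagonal_injective h1) ⟨i, hj.2⟩
  exact_mod_cast h2.symm

/-- A matrix supported on `K` of the diagonal positions has rank at most `K`. -/
lemma rank_assemble_le (U : Mat m (min m n)) (V : Mat n (min m n)) (a : ℕ → ℝ)
    (S : Finset (Fin (min m n))) (h : ∀ i ∉ S, a (i.val + 1) = 0) :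
    (assemble U a V).rank ≤ S.card := by
  classical
  refine (Matrix.rank_mul_le_left _ _).trans ((Matrix.rank_mul_le_right _ _).trans ?_)
  rw [Matrix.rank_diagonal, Fintype.card_subtype]
  refine Finset.card_le_card fun i hi => ?_
  by_contra hS
  simp [h i hS] at hi

/-- A matrix factors through an orthonormal frame of its column space. -/
lemma exists_orthonormal_factorization (A : Mat m n) :
    ∃ (Q : Mat m A.rank) (C : Mat A.rank n), Qᴴ * Q = 1 ∧ A = Q * C := by
  set W := LinearMap.range (Matrix.toEuclideanLin A) with hW
  have hrank : Module.finrank ℂ W = A.rank := (Matrix.rank_eq_finrank_range_toLin A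
    (EuclideanSpace.basisFun (Fin m) ℂ).toBasis (EuclideanSpace.basisFun (Fin n) ℂ).toBasis).symm
  let b := (stdOrthonormalBasis ℂ W).reindex (finCongr hrank)
  have hmem (j : Fin n) : Matrix.toEuclideanLin A (EuclideanSpace.single j 1) ∈ W := ⟨_, rfl⟩
  refine ⟨Matrix.of fun i k => (b k : EuclideanSpace ℂ (Fin m)) i,
    Matrix.of fun k j => inner ℂ (b k) (⟨_, hmem j⟩ : W), ?_, ?_⟩
  · ext k l
    have := orthonormal_iff_ite.mp b.orthonormal k l
    rw [Submodule.coe_inner, EuclideanSpace.inner_eq_star_dotProduct] at this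
    rw [Matrix.one_apply, ← this, Matrix.mul_apply, dotProduct]
    refine Finset.sum_congr rfl fun i _ => ?_
    simp [mul_comm]
  · ext i j
    have h := congrArg (fun w : W => (w : EuclideanSpace ℂ (Fin m)) i)
      (b.sum_repr' (⟨_, hmem j⟩ : W))
    simp only [Submodule.coe_sum, Submodule.coe_smul] at h
    simp [Matrix.toEuclideanLin] at h
    rw [← h, Matrix.mul_apply]
    simp [mul_comm]

end Assemble

/-! ### Weighted sums and truncations -/

lemma sum_Icc_split {K N : ℕ} (hKN : K ≤ N) (f : ℕ → ℝ) :
    ∑ j ∈ Icc 1 N, f j = ∑ j ∈ Icc 1 K, f j + ∑ j ∈ Icc (K + 1) N, f j := by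
  have h := Finset.sum_Ioc_consecutive f (Nat.zero_le K) hKN
  simpa [← Finset.Icc_add_one_left_eq_Ioc] using h.symm

/-- Weights in `[0, 1]` of total mass at most `K` do not beat the first `K` terms of a sequence
that is at least `t` on those and at most `t` afterwards. -/
lemma sum_weights_mul_le {K N : ℕ} (hKN : K ≤ N) {t : ℝ} (ht : 0 ≤ t) {z p : ℕ → ℝ}
    (hz : ∀ j ∈ Icc 1 K, t ≤ z j) (hz' : ∀ j ∈ Icc (K + 1) N, z j ≤ t)
    (hp0 : ∀ j ∈ Icc 1 N, 0 ≤ p j) (hp1 : ∀ j ∈ Icc 1 N, p j ≤ 1)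
    (hp : ∑ j ∈ Icc 1 N, p j ≤ K) : ∑ j ∈ Icc 1 N, p j * z j ≤ ∑ j ∈ Icc 1 K, z j := by
  rw [sum_Icc_split hKN] at hp ⊢
  have h1 : ∑ j ∈ Icc 1 K, p j * z j ≤ ∑ j ∈ Icc 1 K, (z j - t + t * p j) := by
    refine Finset.sum_le_sum fun j hj => ?_
    have := hp1 j (Finset.Icc_subset_Icc_right hKN hj)
    nlinarith [hz j hj]
  have h2 : ∑ j ∈ Icc (K + 1) N, p j * z j ≤ ∑ j ∈ Icc (K + 1) N, t * p j := by
    refine Finset.sum_le_sum fun j hj => ?_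
    have := hp0 j (Finset.Icc_subset_Icc_left (Nat.le_add_left 1 K) hj)
    nlinarith [hz' j hj]
  rw [Finset.sum_add_distrib, Finset.sum_sub_distrib, ← Finset.mul_sum] at h1
  rw [← Finset.mul_sum] at h2
  simp only [Finset.sum_const, Nat.card_Icc, Nat.add_sub_cancel, nsmul_eq_mul] at h1
  nlinarith

/-- Among all `K`-element sets, one maximizing the sum of `c` beats every fractional choice. -/
lemma exists_card_eq_sum_weights_le {ι : Type*} [Fintype ι] {K : ℕ}
    (hK : K ≤ Fintype.card ι) {θ : ι → ℝ} (h0 : ∀ i, 0 ≤ θ i) (h1 : ∀ i, θ i ≤ 1)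
    (hθ : ∑ i, θ i = K) (c : ι → ℝ) :
    ∃ S : Finset ι, S.card = K ∧ ∑ i, θ i * c i ≤ ∑ i ∈ S, c i := by
  classical
  obtain ⟨S, hS, hmax⟩ := Finset.exists_max_image (powersetCard K (univ : Finset ι))
    (fun S => ∑ i ∈ S, c i) (Finset.powersetCard_nonempty.mpr (by simpa using hK))
  have hcard : S.card = K := (Finset.mem_powersetCard.mp hS).2
  have hex : ∀ i ∈ S, ∀ j ∉ S, c j ≤ c i := by
    intro i hi j hj
    have hj' : j ∉ S.erase i := fun h => hj (Finset.mem_of_mem_erase h)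
    have h := hmax (insert j (S.erase i)) (by
      rw [Finset.mem_powersetCard]
      refine ⟨Finset.subset_univ _, ?_⟩
      rw [Finset.card_insert_of_notMem hj', Finset.card_erase_add_one hi, hcard])
    rw [Finset.sum_insert hj', ← Finset.add_sum_erase S c hi] at h
    linarith
  refine ⟨S, hcard, ?_⟩
  obtain ⟨τ, hτ, hτ'⟩ : ∃ τ, (∀ i ∈ S, τ ≤ c i) ∧ ∀ j ∉ S, c j ≤ τ := by
    rcases S.eq_empty_or_nonempty with rfl | hne
    · exact ⟨∑ i, |c i|, by simp, fun j _ => (le_abs_self _).trans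
        (Finset.single_le_sum (f := fun i => |c i|) (fun i _ => abs_nonneg _) (mem_univ j))⟩
    · obtain ⟨i, hi, hmin⟩ := Finset.exists_min_image S c hne
      exact ⟨c i, hmin, hex i hi⟩
  -- subtracting the threshold `τ` makes the terms in `S` nonnegative and the others nonpositive
  have h2 : ∑ i, θ i * c i ≤ ∑ i, (τ * θ i + if i ∈ S then c i - τ else 0) := by
    refine Finset.sum_le_sum fun i _ => ?_
    split_ifs with hi
    · nlinarith [hτ i hi, h1 i]
    · nlinarith [hτ' i hi, h0 i]
  rw [Finset.sum_add_distrib, ← Finset.mul_sum, hθ, Finset.sum_ite_mem, Finset.univ_inter,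
    Finset.sum_sub_distrib, Finset.sum_const, hcard, nsmul_eq_mul] at h2
  linarith

/-! ### The conjugate, the envelope and a duality certificate -/

section Envelope

variable {m n K : ℕ}

/-- The bound behind the conjugate of `I`, for a matrix with singular values `y`: a competitor of
rank at most `K` factors as `A = Q C` with `Q` orthonormal, so completing the square leaves
`‖Qᴴ Y‖²`, a weighted sum of the `y j ^ 2` whose weights lie in `[0, 1]` and add up to at most `K`
by Bessel. -/
lemma two_mul_frobInner_sub_norm_sq_le (hKN : K ≤ min m n) {U : Mat m (min m n)}
    {V : Mat n (min m n)} (hU : Uᴴ * U = 1) (hV : Vᴴ * V = 1) {y : ℕ → ℝ} {t : ℝ} (ht : 0 ≤ t)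
    (hy : ∀ j ∈ Icc 1 K, t ≤ y j) (hy0 : ∀ j ∈ Icc (K + 1) (min m n), 0 ≤ y j)
    (hy' : ∀ j ∈ Icc (K + 1) (min m n), y j ≤ t) {A : Mat m n} (hA : A.rank ≤ K) :
    2 * frobInner A (assemble U y V) - ‖A‖ ^ 2 ≤ ∑ j ∈ Icc 1 K, y j ^ 2 := by
  obtain ⟨Q, C, hQ, hAQ⟩ := exists_orthonormal_factorization A
  have hsquare : 2 * frobInner A (assemble U y V) - ‖A‖ ^ 2 ≤ ‖Qᴴ * assemble U y V‖ ^ 2 := by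
    have h := norm_sub_sq_eq C (Qᴴ * assemble U y V)
    have h1 : frobInner A (assemble U y V) = frobInner C (Qᴴ * assemble U y V) := by
      rw [← frobInner_mul_left, ← hAQ]
    have h2 : ‖A‖ ^ 2 = ‖C‖ ^ 2 := by rw [← norm_mul_sq_of_orthonormal hQ C, ← hAQ]
    nlinarith [sq_nonneg ‖C - Qᴴ * assemble U y V‖]
  -- `p j` is the squared length of `Qᴴ u_j`, for `u_j` the column of `U` of index `j`
  let p : ℕ → ℝ := fun j =>
    if h : j - 1 < min m n then ∑ i, ‖(Qᴴ * U) i ⟨j - 1, h⟩‖ ^ 2 else 0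
  have hpfin (j : Fin (min m n)) : p (j.val + 1) = ∑ i, ‖(Qᴴ * U) i j‖ ^ 2 :=
    dif_pos (show j.val + 1 - 1 < min m n from j.isLt)
  have hnorm : ‖Qᴴ * assemble U y V‖ ^ 2 = ∑ j ∈ Icc 1 (min m n), p j * y j ^ 2 := by
    rw [assemble, ← Matrix.mul_assoc, norm_mul_conjTranspose_sq_of_orthonormal hV,
      ← Matrix.mul_assoc, ← frobInner_self, frobInner_self_eq_sum, Finset.sum_comm,
      ← sum_fin_succ_eq_sum_Icc _ fun j => p j * y j ^ 2]
    refine Finset.sum_congr rfl fun j _ => ?_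
    rw [hpfin, Finset.sum_mul]
    refine Finset.sum_congr rfl fun i _ => ?_
    rw [Matrix.mul_diagonal, norm_mul, mul_pow, Complex.norm_real, Real.norm_eq_abs, sq_abs]
  rw [hnorm] at hsquare
  refine hsquare.trans (sum_weights_mul_le hKN (sq_nonneg t) ?_ ?_ ?_ ?_ ?_)
  · exact fun j hj => pow_le_pow_left₀ ht (hy j hj) 2
  · exact fun j hj => pow_le_pow_left₀ (hy0 j hj) (hy' j hj) 2
  · intro j _
    dsimp only [p]
    split_ifs <;> positivity
  · intro j _
    dsimp only [p]
    split_ifs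
    · exact sum_norm_sq_col_conjTranspose_mul_le hQ hU _
    · exact zero_le_one
  · rw [← sum_fin_succ_eq_sum_Icc]
    simp_rw [hpfin]
    rw [Finset.sum_comm]
    have hrow (i : Fin A.rank) : ∑ j, ‖(Qᴴ * U) i j‖ ^ 2 ≤ 1 := by
      have h := sum_norm_sq_col_conjTranspose_mul_le hU hQ i
      have hW : Uᴴ * Q = (Qᴴ * U)ᴴ := by simp [Matrix.conjTranspose_mul]
      simpa [hW, Matrix.conjTranspose_apply, -Matrix.conjTranspose_mul] using h
    calc ∑ i, ∑ j, ‖(Qᴴ * U) i j‖ ^ 2 ≤ ∑ _i : Fin A.rank, (1 : ℝ) :=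
          Finset.sum_le_sum fun i _ => hrow i
      _ ≤ K := by simpa using hA

lemma le_fenchel_fixedRankFun (F B : Mat m n) {A : Mat m n} (hA : A.rank ≤ K) :
    ((frobInner A B - ‖A - F‖ ^ 2 : ℝ) : EReal) ≤ fenchel (fixedRankFun K F) B := by
  refine le_trans (le_of_eq ?_) (le_iSup (fun A => (frobInner A B : EReal) - fixedRankFun K F A) A)
  simp [fixedRankFun, rankIndicator, hA]

lemma fenchel_fixedRankFun_le (F B : Mat m n) {c : ℝ}
    (h : ∀ A : Mat m n, A.rank ≤ K → frobInner A B - ‖A - F‖ ^ 2 ≤ c) :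
    fenchel (fixedRankFun K F) B ≤ c := by
  refine iSup_le fun A => ?_
  by_cases hA : A.rank ≤ K
  · simp only [fixedRankFun, rankIndicator, hA, if_true, zero_add]
    exact_mod_cast h A hA
  · simp only [fixedRankFun, rankIndicator, hA, if_false]
    rw [EReal.top_add_coe, EReal.sub_top]
    exact bot_le

lemma le_fixedRankEnvelope (F B A : Mat m n) {c : ℝ} (h : fenchel (fixedRankFun K F) B ≤ c) :
    ((frobInner B A - c : ℝ) : EReal) ≤ fixedRankEnvelope K F A := by
  refine le_trans ?_
    (le_iSup (fun B => (frobInner B A : EReal) - fenchel (fixedRankFun K F) B) B)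
  rw [EReal.coe_sub]
  exact EReal.sub_le_sub le_rfl h

lemma fixedRankEnvelope_le (F A : Mat m n) {d : ℝ}
    (h : ∀ B, ∃ c : ℝ, (c : EReal) ≤ fenchel (fixedRankFun K F) B ∧ frobInner B A - c ≤ d) :
    fixedRankEnvelope K F A ≤ d := by
  refine iSup_le fun B => ?_
  obtain ⟨c, hc, hd⟩ := h B
  calc (frobInner B A : EReal) - fenchel (fixedRankFun K F) B ≤ (frobInner B A : EReal) - c :=
        EReal.sub_le_sub le_rfl hc
    _ ≤ d := by exact_mod_cast hd

/-- Duality certificate. If the conjugate of `I` is at most `c` at `B = 2 ρ (F - A₀)`, and the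
envelope at `A₀` does not exceed the value of the resulting affine minorant, then the minorant
plus `ρ ‖A - F‖²` is a quadratic with vertex `A₀`, and `A₀` is the proximal point. -/
lemma proxSolutions_eq_singleton {ρ : ℝ} (hρ : 0 < ρ) {F A₀ : Mat m n} {c : ℝ}
    (hc : fenchel (fixedRankFun K F) ((2 * ρ) • (F - A₀)) ≤ c)
    (hA₀ : fixedRankEnvelope K F A₀ ≤ ((frobInner ((2 * ρ) • (F - A₀)) A₀ - c : ℝ) : EReal)) :
    proxSolutions K ρ F = {A₀} := by
  set B := (2 * ρ) • (F - A₀) with hB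
  have hval : fixedRankEnvelope K F A₀ = ((frobInner B A₀ - c : ℝ) : EReal) :=
    le_antisymm hA₀ (le_fixedRankEnvelope F B A₀ hc)
  have hquad (A : Mat m n) : frobInner B A - c + ρ * ‖A - F‖ ^ 2 =
      frobInner B A₀ - c + ρ * ‖A₀ - F‖ ^ 2 + ρ * ‖A - A₀‖ ^ 2 := by
    rw [hB, frobInner_smul_left, frobInner_smul_left, frobInner_sub_left, frobInner_sub_left,
      norm_sub_sq_eq, norm_sub_sq_eq, norm_sub_sq_eq, frobInner_self, frobInner_comm F A,
      frobInner_comm F A₀, frobInner_comm A₀ A]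
    ring
  have hlower (A : Mat m n) : ((frobInner B A₀ - c + ρ * ‖A₀ - F‖ ^ 2 + ρ * ‖A - A₀‖ ^ 2 : ℝ) :
      EReal) ≤ fixedRankEnvelope K F A + ((ρ * ‖A - F‖ ^ 2 : ℝ) : EReal) := by
    rw [← hquad, EReal.coe_add]
    exact add_le_add (le_fixedRankEnvelope F B A hc) le_rfl
  ext A
  simp only [proxSolutions, Set.mem_ofPred_eq, Set.mem_singleton_iff, isMinOn_univ_iff]
  constructor
  · intro hA
    have h := (hlower A).trans (hA A₀)
    rw [hval, ← EReal.coe_add, EReal.coe_le_coe_iff] at h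
    have h0 : ‖A - A₀‖ ^ 2 ≤ 0 := by nlinarith
    exact sub_eq_zero.mp (norm_eq_zero.mp (pow_eq_zero_iff two_ne_zero |>.mp
      (le_antisymm h0 (sq_nonneg _))))
  · rintro rfl A'
    refine le_trans ?_ (hlower A')
    rw [hval, ← EReal.coe_add, EReal.coe_le_coe_iff]
    have : 0 ≤ ρ * ‖A' - A‖ ^ 2 := by positivity
    linarith

/-- The proximal point from a dual sequence `y` and weights `θ`: here `θ y` are the singular
values of the proximal point, `φ + ρ (φ - θ y) = y` is stationarity, and the remaining hypotheses
say that `θ y` is a convex combination of best rank-`K` truncations of `y`. -/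
lemma proxSolutions_eq_of_weights (hKN : K ≤ min m n) {ρ : ℝ} (hρ : 0 < ρ) {F : Mat m n}
    {U : Mat m (min m n)} {V : Mat n (min m n)} (hU : Uᴴ * U = 1) (hV : Vᴴ * V = 1)
    {φ y θ : ℕ → ℝ} (hF : F = assemble U φ V) {t : ℝ} (ht : 0 ≤ t)
    (hy : ∀ j ∈ Icc 1 K, t ≤ y j) (hy0 : ∀ j ∈ Icc (K + 1) (min m n), 0 ≤ y j)
    (hy' : ∀ j ∈ Icc (K + 1) (min m n), y j ≤ t)
    (hθ0 : ∀ j ∈ Icc 1 (min m n), 0 ≤ θ j) (hθ1 : ∀ j ∈ Icc 1 (min m n), θ j ≤ 1)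
    (hθ : ∑ j ∈ Icc 1 (min m n), θ j = K)
    (hstat : ∀ j ∈ Icc 1 (min m n), φ j + ρ * (φ j - θ j * y j) = y j)
    (hcompl : ∑ j ∈ Icc 1 (min m n), θ j * y j ^ 2 = ∑ j ∈ Icc 1 K, y j ^ 2) :
    proxSolutions K ρ F = {assemble U (fun j => θ j * y j) V} := by
  set A₀ := assemble U (fun j => θ j * y j) V with hA₀
  set Y := assemble U y V with hY
  set T := ∑ j ∈ Icc 1 K, y j ^ 2 with hT
  have hB : (2 * ρ) • (F - A₀) = (2 : ℝ) • (Y - F) := by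
    rw [hF, hA₀, hY, assemble_sub, assemble_sub, smul_assemble, smul_assemble]
    refine assemble_congr U V fun j hj => ?_
    linear_combination 2 * hstat j (by simpa using hj)
  have hexpand (A B : Mat m n) : frobInner A B - ‖A - F‖ ^ 2 =
      2 * frobInner A ((1 / 2 : ℝ) • B + F) - ‖A‖ ^ 2 - ‖F‖ ^ 2 := by
    rw [norm_sub_sq_eq, frobInner_add_right, frobInner_smul_right]
    ring
  refine proxSolutions_eq_singleton hρ (c := T - ‖F‖ ^ 2) ?_ ?_
  · refine fenchel_fixedRankFun_le F _ fun A hA => ?_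
    rw [hexpand, hB, smul_smul]
    have h := two_mul_frobInner_sub_norm_sq_le hKN hU hV ht hy hy0 hy' hA
    norm_num
    linarith
  · refine fixedRankEnvelope_le F A₀ fun B => ?_
    set Z := (1 / 2 : ℝ) • B + F with hZ
    -- the truncation of `Y` to `S` is tested against `Z`; its score is the sum of `w` over `S`
    let w : Fin (min m n) → ℝ := fun i =>
      2 * (y (i.val + 1) * ((Uᴴ * Z * V) i i).re) - y (i.val + 1) ^ 2
    obtain ⟨S, hS, hSw⟩ := exists_card_eq_sum_weights_le (K := K)
      (θ := fun i : Fin (min m n) => θ (i.val + 1)) (by simpa using hKN)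
      (fun i => hθ0 _ (by simp; omega)) (fun i => hθ1 _ (by simp; omega))
      (by rw [sum_fin_succ_eq_sum_Icc, hθ]) w
    let yS : ℕ → ℝ := fun j => if ∃ i ∈ S, i.val + 1 = j then y j else 0
    have hyS (i : Fin (min m n)) : yS (i.val + 1) = if i ∈ S then y (i.val + 1) else 0 := by
      have : (∃ i' ∈ S, i'.val + 1 = i.val + 1) ↔ i ∈ S := by
        constructor
        · rintro ⟨i', hi', h⟩
          rwa [← Fin.ext (Nat.succ_injective h)]
        · exact fun hi => ⟨i, hi, rfl⟩
      simp only [yS, this]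
    have hrank : (assemble U yS V).rank ≤ K :=
      (rank_assemble_le U V yS S fun i hi => by rw [hyS, if_neg hi]).trans hS.le
    refine ⟨_, le_fenchel_fixedRankFun F B hrank, ?_⟩
    have hscore : 2 * frobInner (assemble U yS V) Z - ‖assemble U yS V‖ ^ 2 = ∑ i ∈ S, w i := by
      rw [← frobInner_self, frobInner_assemble_assemble hU hV, frobInner_assemble_left,
        ← sum_fin_succ_eq_sum_Icc _ fun j => yS j * yS j, Finset.mul_sum,
        ← Finset.sum_sub_distrib, ← Finset.univ_inter S, ← Finset.sum_ite_mem]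
      refine Finset.sum_congr rfl fun i _ => ?_
      rw [hyS]
      split_ifs
      · simp only [w]; ring
      · ring
    have hθw : ∑ i : Fin (min m n), θ (i.val + 1) * w i = 2 * frobInner A₀ Z - T := by
      rw [← hcompl, hA₀, frobInner_assemble_left,
        ← sum_fin_succ_eq_sum_Icc _ fun j => θ j * y j ^ 2, Finset.mul_sum,
        ← Finset.sum_sub_distrib]
      refine Finset.sum_congr rfl fun i _ => ?_
      simp only [w]; ring
    have hAY : frobInner A₀ Y = T := by
      rw [hA₀, hY, frobInner_assemble_assemble hU hV, ← hcompl]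
      refine Finset.sum_congr rfl fun j _ => ?_
      ring
    have hAZ : frobInner A₀ Z = 1 / 2 * frobInner A₀ B + frobInner A₀ F := by
      rw [hZ, frobInner_add_right, frobInner_smul_right]
    rw [hexpand, ← hZ, hscore, frobInner_comm B, hB, frobInner_smul_left, frobInner_sub_left,
      frobInner_comm Y, frobInner_comm F, hAY]
    linarith

end Envelope

/-! ### The scalar problem for the threshold `s` -/

section Scalar

variable {K N : ℕ} {ρ : ℝ} {φ : ℕ → ℝ} {s : ℝ}

/-- Half of the derivative of `sObjective`. -/
noncomputable def sSlope (N K : ℕ) (ρ : ℝ) (φ : ℕ → ℝ) (s : ℝ) : ℝ :=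
  ∑ j ∈ Icc 1 K, (max (φ j) s - φ j) + ∑ j ∈ Icc (K + 1) N, (min (φ j) (s / (1 + ρ)) - φ j)

lemma continuous_sSlope : Continuous (sSlope N K ρ φ) := by
  unfold sSlope
  fun_prop

/-- The tangent inequality for the convex function `sObjective`; on `[φ K, ∞)` its summand of
index `K` is a square, which makes it strongly convex there. -/
lemma sObjective_add_le (hK : 1 ≤ K) (hρ : 0 < ρ) {s₀ : ℝ} (hs₀ : φ K ≤ s₀) (hs : φ K ≤ s) :
    sObjective N K ρ φ s₀ + 2 * sSlope N K ρ φ s₀ * (s - s₀) + (s - s₀) ^ 2 ≤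
      sObjective N K ρ φ s := by
  have h1 : ∑ j ∈ Icc 1 K, ((max (φ j) s₀ - φ j) ^ 2 + 2 * (s - s₀) * (max (φ j) s₀ - φ j) +
      if j = K then (s - s₀) ^ 2 else 0) ≤ ∑ j ∈ Icc 1 K, (max (φ j) s - φ j) ^ 2 := by
    refine Finset.sum_le_sum fun j _ => ?_
    split_ifs with hj
    · subst hj
      rw [max_eq_right hs, max_eq_right hs₀]
      apply le_of_eq
      ring
    · rcases le_total (φ j) s with h | h <;> rcases le_total (φ j) s₀ with h' | h' <;>
        simp only [max_eq_left, max_eq_right, h, h'] <;> nlinarith [sq_nonneg (s - s₀)]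
  have h2 : ∑ j ∈ Icc (K + 1) N, ((1 + ρ) * (min (φ j) (s₀ / (1 + ρ)) - φ j) ^ 2 +
      2 * (s - s₀) * (min (φ j) (s₀ / (1 + ρ)) - φ j)) ≤
        ∑ j ∈ Icc (K + 1) N, (1 + ρ) * (min (φ j) (s / (1 + ρ)) - φ j) ^ 2 := by
    refine Finset.sum_le_sum fun j _ => ?_
    have hss : s - s₀ = (1 + ρ) * (s / (1 + ρ) - s₀ / (1 + ρ)) := by field_simp
    rw [hss]
    generalize s / (1 + ρ) = u
    generalize s₀ / (1 + ρ) = u₀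
    suffices (min (φ j) u₀ - φ j) ^ 2 + 2 * (u - u₀) * (min (φ j) u₀ - φ j) ≤
        (min (φ j) u - φ j) ^ 2 by nlinarith
    rcases le_total (φ j) u with h | h <;> rcases le_total (φ j) u₀ with h' | h' <;>
      simp only [min_eq_left, min_eq_right, h, h'] <;> nlinarith [sq_nonneg (u - u₀)]
  rw [Finset.sum_add_distrib, Finset.sum_add_distrib, ← Finset.mul_sum,
    Finset.sum_ite_eq', if_pos (Finset.mem_Icc.mpr ⟨hK, le_rfl⟩)] at h1
  rw [Finset.sum_add_distrib, ← Finset.mul_sum, ← Finset.mul_sum, ← Finset.mul_sum] at h2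
  unfold sObjective sSlope
  linarith

lemma max_sub_eq_zero_of_le (hφ : AntitoneOn φ (Set.Icc 1 N)) (hKN : K < N) (hs : s ≤ φ K)
    {j : ℕ} (hj : j ∈ Icc 1 K) : max (φ j) s - φ j = 0 := by
  obtain ⟨hj1, hjK⟩ := Finset.mem_Icc.mp hj
  rw [max_eq_left (hs.trans (hφ ⟨hj1, by omega⟩ ⟨by omega, by omega⟩ hjK)), sub_self]

lemma min_sub_eq_zero_of_le (hφ : AntitoneOn φ (Set.Icc 1 N)) (hρ : 0 < ρ)
    (hs : (1 + ρ) * φ (K + 1) ≤ s) {j : ℕ} (hj : j ∈ Icc (K + 1) N) :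
    min (φ j) (s / (1 + ρ)) - φ j = 0 := by
  obtain ⟨hjK, hjN⟩ := Finset.mem_Icc.mp hj
  rw [min_eq_left, sub_self]
  have h1 : φ j ≤ φ (K + 1) := hφ ⟨by omega, by omega⟩ ⟨by omega, hjN⟩ hjK
  rw [le_div_iff₀ (by linarith)]
  nlinarith

lemma sSlope_neg (hφ : AntitoneOn φ (Set.Icc 1 N)) (hKN : K < N) (hρ : 0 < ρ)
    (h : φ K < (1 + ρ) * φ (K + 1)) : sSlope N K ρ φ (φ K) < 0 := by
  unfold sSlope
  rw [Finset.sum_eq_zero fun j hj => max_sub_eq_zero_of_le hφ hKN le_rfl hj, zero_add]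
  refine Finset.sum_neg' (fun j _ => sub_nonpos.mpr (min_le_left _ _))
    ⟨K + 1, Finset.mem_Icc.mpr ⟨le_rfl, hKN⟩, ?_⟩
  rw [sub_neg]
  refine (min_le_right _ _).trans_lt ?_
  rw [div_lt_iff₀ (by linarith)]
  linarith

lemma sSlope_pos (hφ : AntitoneOn φ (Set.Icc 1 N)) (hK : 1 ≤ K) (hρ : 0 < ρ)
    (h : φ K < (1 + ρ) * φ (K + 1)) : 0 < sSlope N K ρ φ ((1 + ρ) * φ (K + 1)) := by
  unfold sSlope
  rw [Finset.sum_eq_zero fun j hj => min_sub_eq_zero_of_le hφ hρ le_rfl hj, add_zero]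
  refine Finset.sum_pos' (fun j _ => sub_nonneg.mpr (le_max_left _ _))
    ⟨K, Finset.mem_Icc.mpr ⟨hK, le_rfl⟩, ?_⟩
  rw [sub_pos]
  exact h.trans_le (le_max_right _ _)

lemma exists_sSlope_eq_zero (hφ : AntitoneOn φ (Set.Icc 1 N)) (hK : 1 ≤ K) (hKN : K < N)
    (hρ : 0 < ρ) (h : φ K < (1 + ρ) * φ (K + 1)) :
    ∃ s ∈ Set.Icc (φ K) ((1 + ρ) * φ (K + 1)), sSlope N K ρ φ s = 0 :=
  intermediate_value_Icc h.le continuous_sSlope.continuousOn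
    ⟨(sSlope_neg hφ hKN hρ h).le, (sSlope_pos hφ hK hρ h).le⟩

/-- In the nondegenerate case a zero of the slope is the unique minimizer. -/
lemma isOptimalS_iff_of_lt (hK : 1 ≤ K) (hρ : 0 < ρ) (h : φ K < (1 + ρ) * φ (K + 1)) {s₀ : ℝ}
    (hs₀ : s₀ ∈ Set.Icc (φ K) ((1 + ρ) * φ (K + 1))) (hs₀' : sSlope N K ρ φ s₀ = 0) :
    IsOptimalS N K ρ φ s ↔ s = s₀ := by
  unfold IsOptimalS
  rw [Set.uIcc_of_le h.le]
  constructor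
  · rintro ⟨hs, hmin⟩
    have h1 := sObjective_add_le (N := N) hK hρ hs₀.1 hs.1
    have h2 : sObjective N K ρ φ s ≤ sObjective N K ρ φ s₀ := hmin hs₀
    rw [hs₀'] at h1
    have h3 : (s - s₀) ^ 2 = 0 := le_antisymm (by linarith) (sq_nonneg _)
    exact sub_eq_zero.mp ((pow_eq_zero_iff two_ne_zero).mp h3)
  · rintro rfl
    refine ⟨hs₀, fun s' hs' => ?_⟩
    have h1 := sObjective_add_le (N := N) hK hρ hs₀.1 hs'.1
    rw [hs₀'] at h1
    change sObjective N K ρ φ s ≤ sObjective N K ρ φ s'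
    nlinarith [sq_nonneg (s' - s)]

/-- In the degenerate case the objective vanishes on the whole interval. -/
lemma isOptimalS_iff_of_ge (hφ : AntitoneOn φ (Set.Icc 1 N)) (hKN : K < N)
    (hρ : 0 < ρ) (h : (1 + ρ) * φ (K + 1) ≤ φ K) :
    IsOptimalS N K ρ φ s ↔ s ∈ Set.Icc ((1 + ρ) * φ (K + 1)) (φ K) := by
  unfold IsOptimalS
  rw [Set.uIcc_of_ge h]
  have hzero : ∀ s' ∈ Set.Icc ((1 + ρ) * φ (K + 1)) (φ K), sObjective N K ρ φ s' = 0 := by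
    intro s' hs'
    unfold sObjective
    rw [Finset.sum_eq_zero fun j hj => by rw [max_sub_eq_zero_of_le hφ hKN hs'.2 hj, sq, zero_mul],
      Finset.sum_eq_zero fun j hj => by rw [min_sub_eq_zero_of_le hφ hρ hs'.1 hj, sq, zero_mul],
      mul_zero, add_zero]
  refine ⟨fun hs => hs.1, fun hs => ⟨hs, fun s' hs' => ?_⟩⟩
  change sObjective N K ρ φ s ≤ sObjective N K ρ φ s'
  rw [hzero s hs, hzero s' hs']

lemma exists_isOptimalS (hφ : AntitoneOn φ (Set.Icc 1 N)) (hK : 1 ≤ K) (hKN : K < N)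
    (hρ : 0 < ρ) : ∃ s, IsOptimalS N K ρ φ s := by
  rcases lt_or_ge (φ K) ((1 + ρ) * φ (K + 1)) with h | h
  · obtain ⟨s₀, hs₀, hs₀'⟩ := exists_sSlope_eq_zero hφ hK hKN hρ h
    exact ⟨s₀, (isOptimalS_iff_of_lt hK hρ h hs₀ hs₀').mpr rfl⟩
  · exact ⟨φ K, (isOptimalS_iff_of_ge hφ hKN hρ h).mpr ⟨h, le_rfl⟩⟩

lemma IsOptimalS.sSlope_eq_zero (hφ : AntitoneOn φ (Set.Icc 1 N)) (hK : 1 ≤ K) (hKN : K < N)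
    (hρ : 0 < ρ) (hs : IsOptimalS N K ρ φ s) : sSlope N K ρ φ s = 0 := by
  rcases lt_or_ge (φ K) ((1 + ρ) * φ (K + 1)) with h | h
  · obtain ⟨s₀, hs₀, hs₀'⟩ := exists_sSlope_eq_zero hφ hK hKN hρ h
    rwa [(isOptimalS_iff_of_lt hK hρ h hs₀ hs₀').mp hs]
  · obtain ⟨h1, h2⟩ := (isOptimalS_iff_of_ge hφ hKN hρ h).mp hs
    unfold sSlope
    rw [Finset.sum_eq_zero fun j hj => max_sub_eq_zero_of_le hφ hKN h2 hj,
      Finset.sum_eq_zero fun j hj => min_sub_eq_zero_of_le hφ hρ h1 hj, add_zero]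

/-- In the nondegenerate case the minimizer lies in the interior of the interval. -/
lemma IsOptimalS.mem_Ioo (hφ : AntitoneOn φ (Set.Icc 1 N)) (hK : 1 ≤ K) (hKN : K < N)
    (hρ : 0 < ρ) (h : φ K < (1 + ρ) * φ (K + 1)) (hs : IsOptimalS N K ρ φ s) :
    s ∈ Set.Ioo (φ K) ((1 + ρ) * φ (K + 1)) := by
  have hmem := hs.1
  rw [Set.uIcc_of_le h.le] at hmem
  have hz := hs.sSlope_eq_zero hφ hK hKN hρ
  refine ⟨hmem.1.lt_of_ne ?_, hmem.2.lt_of_ne ?_⟩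
  · rintro rfl
    exact (sSlope_neg hφ hKN hρ h).ne hz
  · rintro rfl
    exact (sSlope_pos hφ hK hρ h).ne' hz

end Scalar

/-! ### The dual sequence and its weights -/

section Dual

variable {K N : ℕ} {ρ : ℝ} {φ : ℕ → ℝ} {s : ℝ}

/-- The singular values of `F + B / 2`, for `B` the optimal dual variable: those of `F` raised to
`s` in the first `K` places, and those of `(1 + ρ) F` cut down to `s` in the others. -/
noncomputable def dualValues (K : ℕ) (ρ : ℝ) (φ : ℕ → ℝ) (s : ℝ) (j : ℕ) : ℝ :=
  if j ≤ K then max (φ j) s else (1 + ρ) * min (φ j) (s / (1 + ρ))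

/-- The ratio of the singular values of the proximal point to `dualValues`. For `s = 0` the
quotients are `0`, so that the weights are `1` in the first `K` places and `0` in the others. -/
noncomputable def dualWeights (K : ℕ) (ρ : ℝ) (φ : ℕ → ℝ) (s : ℝ) (j : ℕ) : ℝ :=
  if j ≤ K then 1 - (1 + ρ) / (ρ * s) * (max (φ j) s - φ j)
  else -((1 + ρ) / (ρ * s)) * (min (φ j) (s / (1 + ρ)) - φ j)

lemma nonneg_and_bounds_of_mem_uIcc (hφ : AntitoneOn φ (Set.Icc 1 N))
    (hφ0 : ∀ j ∈ Set.Icc 1 N, 0 ≤ φ j) (hK : 1 ≤ K) (hKN : K < N) (hρ : 0 < ρ)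
    (hs : s ∈ Set.uIcc (φ K) ((1 + ρ) * φ (K + 1))) :
    0 ≤ s ∧ (∀ j ∈ Icc 1 K, s ≤ (1 + ρ) * φ j) ∧ ∀ j ∈ Icc (K + 1) N, φ j ≤ s := by
  have hKK : φ (K + 1) ≤ φ K := hφ ⟨hK, hKN.le⟩ ⟨by omega, hKN⟩ (Nat.le_succ K)
  have h0 : 0 ≤ φ (K + 1) := hφ0 _ ⟨by omega, hKN⟩
  have hlow : φ (K + 1) ≤ s :=
    (le_min hKK (by nlinarith)).trans hs.1
  have hup : s ≤ (1 + ρ) * φ K := hs.2.trans (max_le (by nlinarith) (by nlinarith))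
  refine ⟨h0.trans hlow, fun j hj => ?_, fun j hj => ?_⟩
  · obtain ⟨hj1, hjK⟩ := Finset.mem_Icc.mp hj
    have : φ K ≤ φ j := hφ ⟨hj1, by omega⟩ ⟨hK, hKN.le⟩ hjK
    nlinarith
  · obtain ⟨hjK, hjN⟩ := Finset.mem_Icc.mp hj
    exact (hφ ⟨by omega, hKN⟩ ⟨by omega, hjN⟩ hjK).trans hlow

/-- For `s` in the interval, the two cases of `dualValues` are the same projection. -/
lemma dualValues_eq_max_min (hφ0 : ∀ j ∈ Set.Icc 1 N, 0 ≤ φ j) (hρ : 0 < ρ)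
    (hup : ∀ j ∈ Icc 1 K, s ≤ (1 + ρ) * φ j) (hlow : ∀ j ∈ Icc (K + 1) N, φ j ≤ s)
    {j : ℕ} (hj : j ∈ Set.Icc 1 N) :
    dualValues K ρ φ s j = max (φ j) (min s ((1 + ρ) * φ j)) := by
  have hjj : φ j ≤ (1 + ρ) * φ j := by nlinarith [hφ0 j hj]
  unfold dualValues
  split_ifs with hjK
  · rw [min_eq_left (hup j (Finset.mem_Icc.mpr ⟨hj.1, hjK⟩))]
  · have h1 := hlow j (Finset.mem_Icc.mpr ⟨by omega, hj.2⟩)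
    rw [max_eq_right (le_min h1 hjj), mul_min_of_nonneg _ _ (by linarith : 0 ≤ 1 + ρ),
      mul_div_cancel₀ _ (by linarith : 1 + ρ ≠ 0), min_comm]

/-- With the indices that `s` determines, `proxValues` solves the stationarity equation
`φ + ρ (φ - α) = y` for the dual sequence `y`. -/
lemma proxValues_eq_sub_div (hφ : AntitoneOn φ (Set.Icc 1 N))
    (hφ0 : ∀ j ∈ Set.Icc 1 N, 0 ≤ φ j) (hρ : 0 < ρ) {k₁ k₂ : ℕ} (hk₁ : IsFirstBelow N φ s k₁)
    (hk₂ : IsLastAbove N φ (s / (1 + ρ)) k₂) {j : ℕ} (hj : j ∈ Set.Icc 1 N) :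
    proxValues φ ρ s k₁ k₂ j = φ j - (max (φ j) (min s ((1 + ρ) * φ j)) - φ j) / ρ := by
  have hjj : φ j ≤ (1 + ρ) * φ j := by nlinarith [hφ0 j hj]
  have hbelow (h : k₁ ≤ j) : φ j < s := by
    rcases hk₁.1 with h1 | ⟨h1, h2⟩
    · exact absurd hj.2 (by omega)
    · exact (hφ h1 hj h).trans_lt h2
  unfold proxValues
  split_ifs with h1 h2
  · have : s ≤ φ j := by
      by_contra! hlt
      exact absurd (hk₁.2 (Or.inr ⟨hj, hlt⟩)) (by omega)
    rw [max_eq_left ((min_le_left _ _).trans this), sub_self, zero_div, sub_zero]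
  · have hs := hbelow (by omega)
    have habove : s ≤ (1 + ρ) * φ j := by
      rcases hk₂.1 with h3 | ⟨h3, h4⟩
      · exact absurd hj.1 (by omega)
      · rw [div_lt_iff₀ (by linarith)] at h4
        nlinarith [hφ hj h3 h2]
    rw [min_eq_left habove, max_eq_right hs.le]
  · have hs := hbelow (by omega)
    have habove : (1 + ρ) * φ j ≤ s := by
      by_contra! hlt
      refine absurd (hk₂.2 (Or.inr ⟨hj, ?_⟩)) (by omega)
      rw [div_lt_iff₀ (by linarith)]
      linarith
    rw [min_eq_right habove, max_eq_right hjj]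
    field_simp
    ring

lemma dualWeights_mem_Icc (hρ : 0 < ρ) (hs0 : 0 ≤ s)
    (hup : ∀ j ∈ Icc 1 K, s ≤ (1 + ρ) * φ j) (hlow : ∀ j ∈ Icc (K + 1) N, φ j ≤ s)
    {j : ℕ} (hj : j ∈ Icc 1 N) : dualWeights K ρ φ s j ∈ Set.Icc (0 : ℝ) 1 := by
  obtain ⟨hj1, hjN⟩ := Finset.mem_Icc.mp hj
  rcases hs0.eq_or_lt with rfl | hs
  · unfold dualWeights
    split_ifs <;> simp
  have hc : 0 < (1 + ρ) / (ρ * s) := by positivity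
  unfold dualWeights
  split_ifs with hjK
  · have h0 : 0 ≤ max (φ j) s - φ j := sub_nonneg.mpr (le_max_left _ _)
    have h1 : (1 + ρ) / (ρ * s) * (max (φ j) s - φ j) ≤ 1 := by
      rw [div_mul_eq_mul_div, div_le_one (by positivity)]
      have := hup j (Finset.mem_Icc.mpr ⟨hj1, hjK⟩)
      rcases le_total (φ j) s with h | h
      · rw [max_eq_right h]; nlinarith
      · rw [max_eq_left h]; nlinarith
    have h2 := mul_nonneg hc.le h0
    constructor <;> linarith
  · have h0 : min (φ j) (s / (1 + ρ)) - φ j ≤ 0 := sub_nonpos.mpr (min_le_left _ _)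
    have h1 : -((1 + ρ) / (ρ * s)) * (min (φ j) (s / (1 + ρ)) - φ j) ≤ 1 := by
      rw [neg_mul, ← mul_neg, div_mul_eq_mul_div, div_le_one (by positivity)]
      have := hlow j (Finset.mem_Icc.mpr ⟨by omega, hjN⟩)
      rcases le_total (φ j) (s / (1 + ρ)) with h | h
      · rw [min_eq_left h]; nlinarith
      · rw [min_eq_right h, neg_sub, mul_sub, mul_div_cancel₀ _ (by linarith : 1 + ρ ≠ 0)]
        nlinarith
    exact ⟨by nlinarith, h1⟩

/-- The total weight differs from `K` by a multiple of the slope of the scalar objective. -/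
lemma sum_dualWeights (hKN : K < N) (hslope : sSlope N K ρ φ s = 0) :
    ∑ j ∈ Icc 1 N, dualWeights K ρ φ s j = K := by
  have h1 : ∑ j ∈ Icc 1 K, dualWeights K ρ φ s j =
      ∑ j ∈ Icc 1 K, (1 - (1 + ρ) / (ρ * s) * (max (φ j) s - φ j)) :=
    Finset.sum_congr rfl fun j hj => if_pos (Finset.mem_Icc.mp hj).2
  have h2 : ∑ j ∈ Icc (K + 1) N, dualWeights K ρ φ s j =
      ∑ j ∈ Icc (K + 1) N, -((1 + ρ) / (ρ * s)) * (min (φ j) (s / (1 + ρ)) - φ j) :=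
    Finset.sum_congr rfl fun j hj => if_neg (by have := (Finset.mem_Icc.mp hj).1; omega)
  rw [sum_Icc_split hKN.le, h1, h2, Finset.sum_sub_distrib, ← Finset.mul_sum, ← Finset.mul_sum]
  simp only [Finset.sum_const, Nat.card_Icc, Nat.add_sub_cancel, nsmul_eq_mul, mul_one]
  unfold sSlope at hslope
  linear_combination -((1 + ρ) / (ρ * s)) * hslope

lemma add_mul_sub_dualWeights_mul_dualValues (hφ0 : ∀ j ∈ Set.Icc 1 N, 0 ≤ φ j) (hρ : 0 < ρ)
    (hs0 : 0 ≤ s) (hlow : ∀ j ∈ Icc (K + 1) N, φ j ≤ s) {j : ℕ} (hj : j ∈ Set.Icc 1 N) :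
    φ j + ρ * (φ j - dualWeights K ρ φ s j * dualValues K ρ φ s j) = dualValues K ρ φ s j := by
  have h0 := hφ0 j hj
  unfold dualWeights dualValues
  rcases hs0.eq_or_lt with rfl | hs
  · split_ifs with hjK
    · simp [h0]
    · have h1 : φ j = 0 := le_antisymm (hlow j (Finset.mem_Icc.mpr ⟨by omega, hj.2⟩)) h0
      simp [h1]
  have hne : 1 + ρ ≠ 0 := by linarith
  split_ifs with hjK
  · rcases le_total (φ j) s with h | h
    · rw [max_eq_right h]; field_simp; ring
    · rw [max_eq_left h]; ring
  · rcases le_total (φ j) (s / (1 + ρ)) with h | h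
    · rw [min_eq_left h]; ring
    · rw [min_eq_right h]; field_simp; ring

/-- A weight that is neither `0` nor `1` occurs only where the dual sequence equals `s`; since the
weights add up to `K`, weighting leaves the sum of the first `K` squares unchanged. -/
lemma sum_dualWeights_mul_dualValues_sq (hKN : K < N) (hρ : 0 < ρ)
    (hslope : sSlope N K ρ φ s = 0) :
    ∑ j ∈ Icc 1 N, dualWeights K ρ φ s j * dualValues K ρ φ s j ^ 2 =
      ∑ j ∈ Icc 1 K, dualValues K ρ φ s j ^ 2 := by
  have hsum := sum_dualWeights hKN hslope
  rw [sum_Icc_split hKN.le] at hsum ⊢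
  have hne : 1 + ρ ≠ 0 := by linarith
  have h1 : ∑ j ∈ Icc 1 K, dualWeights K ρ φ s j * dualValues K ρ φ s j ^ 2 =
      ∑ j ∈ Icc 1 K, (dualValues K ρ φ s j ^ 2 - s ^ 2 + s ^ 2 * dualWeights K ρ φ s j) := by
    refine Finset.sum_congr rfl fun j hj => ?_
    unfold dualWeights dualValues
    rw [if_pos (Finset.mem_Icc.mp hj).2, if_pos (Finset.mem_Icc.mp hj).2]
    rcases le_total (φ j) s with h | h
    · rw [max_eq_right h]; ring
    · rw [max_eq_left h]; ring
  have h2 : ∑ j ∈ Icc (K + 1) N, dualWeights K ρ φ s j * dualValues K ρ φ s j ^ 2 =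
      ∑ j ∈ Icc (K + 1) N, s ^ 2 * dualWeights K ρ φ s j := by
    refine Finset.sum_congr rfl fun j hj => ?_
    have hj' : ¬ j ≤ K := by have := (Finset.mem_Icc.mp hj).1; omega
    unfold dualWeights dualValues
    rw [if_neg hj', if_neg hj']
    rcases le_total (φ j) (s / (1 + ρ)) with h | h
    · rw [min_eq_left h]; ring
    · rw [min_eq_right h, mul_div_cancel₀ _ hne]; ring
  rw [h1, h2, Finset.sum_add_distrib, Finset.sum_sub_distrib, ← Finset.mul_sum,
    ← Finset.mul_sum, Finset.sum_const, Nat.card_Icc, Nat.add_sub_cancel, nsmul_eq_mul]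
  linear_combination s ^ 2 * hsum

end Dual

/-! ### The proximal point -/

section ProximalPoint

variable {m n K : ℕ} {ρ : ℝ} {F : Mat m n} {U : Mat m (min m n)} {φ : ℕ → ℝ}
  {V : Mat n (min m n)} {s : ℝ}

lemma proxSolutions_eq_of_isOptimalS (hF : IsSVD F U φ V) (hK : 1 ≤ K) (hKN : K < min m n)
    (hρ : 0 < ρ) (hs : IsOptimalS (min m n) K ρ φ s) :
    proxSolutions K ρ F =
      {assemble U (fun j => φ j - (max (φ j) (min s ((1 + ρ) * φ j)) - φ j) / ρ) V} := by
  obtain ⟨hs0, hup, hlow⟩ :=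
    nonneg_and_bounds_of_mem_uIcc hF.antitone hF.nonneg hK hKN hρ hs.1
  have hslope := hs.sSlope_eq_zero hF.antitone hK hKN hρ
  have hpos : 0 < 1 + ρ := by linarith
  have hmem {j : ℕ} (hj : j ∈ Icc (K + 1) (min m n)) : ¬ j ≤ K ∧ j ∈ Set.Icc 1 (min m n) := by
    obtain ⟨h1, h2⟩ := Finset.mem_Icc.mp hj
    exact ⟨by omega, by omega, h2⟩
  have hstat (j : ℕ) (hj : j ∈ Set.Icc 1 (min m n)) :=
    add_mul_sub_dualWeights_mul_dualValues hF.nonneg hρ hs0 hlow hj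
  have key := proxSolutions_eq_of_weights hKN.le hρ hF.left_orthonormal hF.right_orthonormal
    (y := dualValues K ρ φ s) (θ := dualWeights K ρ φ s) hF.eq hs0 ?_ ?_ ?_
    (fun j hj => (dualWeights_mem_Icc hρ hs0 hup hlow hj).1)
    (fun j hj => (dualWeights_mem_Icc hρ hs0 hup hlow hj).2)
    (sum_dualWeights hKN hslope) (fun j hj => hstat j (by simpa using hj))
    (sum_dualWeights_mul_dualValues_sq hKN hρ hslope)
  · rw [key]
    congr 1
    refine assemble_congr U V fun j hj => ?_
    rw [← dualValues_eq_max_min hF.nonneg hρ hup hlow hj]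
    have := hstat j hj
    field_simp
    linarith
  · intro j hj
    rw [dualValues, if_pos (Finset.mem_Icc.mp hj).2]
    exact le_max_right _ _
  · intro j hj
    rw [dualValues, if_neg (hmem hj).1]
    exact mul_nonneg hpos.le (le_min (hF.nonneg j (hmem hj).2) (div_nonneg hs0 hpos.le))
  · intro j hj
    rw [dualValues, if_neg (hmem hj).1, ← le_div_iff₀' hpos]
    exact min_le_right _ _

/-- In the nondegenerate case the indices `K` and `K + 1` lie in the middle range, so that `s` and
its indices describe the proximal point. -/
lemma isProxParam_of_isOptimalS (hF : IsSVD F U φ V) (hK : 1 ≤ K) (hKN : K < min m n)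
    (hρ : 0 < ρ) (h : φ K < (1 + ρ) * φ (K + 1)) (hs : IsOptimalS (min m n) K ρ φ s) {k₁ k₂ : ℕ}
    (hk₁ : IsFirstBelow (min m n) φ s k₁) (hk₂ : IsLastAbove (min m n) φ (s / (1 + ρ)) k₂)
    (hsol : proxSolutions K ρ F = {assemble U (proxValues φ ρ s k₁ k₂) V}) :
    φ k₁ < s ∧ s / (1 + ρ) < φ k₂ ∧ IsProxParam K ρ F U φ V s k₁ k₂ := by
  obtain ⟨hs1, hs2⟩ := hs.mem_Ioo hF.antitone hK hKN hρ h
  have hk₁K : k₁ ≤ K := hk₁.2 (Or.inr ⟨⟨hK, hKN.le⟩, hs1⟩)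
  have hKk₂ : K + 1 ≤ k₂ := by
    refine hk₂.2 (Or.inr ⟨⟨by omega, hKN⟩, ?_⟩)
    rw [div_lt_iff₀ (by linarith)]
    linarith
  obtain ⟨hk₁N, hk₁s⟩ : k₁ ∈ Set.Icc 1 (min m n) ∧ φ k₁ < s :=
    hk₁.1.resolve_left (by omega)
  obtain ⟨hk₂N, hk₂s⟩ : k₂ ∈ Set.Icc 1 (min m n) ∧ s / (1 + ρ) < φ k₂ :=
    hk₂.1.resolve_left (by omega)
  exact ⟨hk₁s, hk₂s, hk₁N.1, hk₁K, by omega, hk₂N.2,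
    (hF.antitone ⟨hK, hKN.le⟩ hk₂N (by omega)).trans_lt hs1, hsol⟩

/-- The proximal point determines the dual sequence, whose entry of index `K` is `s`; for an
optimal threshold this entry is the threshold itself, or `φ K` in the degenerate case. -/
lemma IsProxParam.isOptimalS (hF : IsSVD F U φ V) (hK : 1 ≤ K) (hKN : K < min m n)
    (hρ : 0 < ρ) {k₁ k₂ : ℕ} (hp : IsProxParam K ρ F U φ V s k₁ k₂) :
    IsOptimalS (min m n) K ρ φ s := by
  obtain ⟨_, hk₁K, hKk₂, _, _, hsol⟩ := hp
  obtain ⟨s₀, hs₀⟩ := exists_isOptimalS hF.antitone hK hKN hρ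
  have hKmem : K ∈ Set.Icc 1 (min m n) := ⟨hK, hKN.le⟩
  rw [proxSolutions_eq_of_isOptimalS hF hK hKN hρ hs₀, Set.singleton_eq_singleton_iff] at hsol
  have hval := assemble_injOn hF.left_orthonormal hF.right_orthonormal hsol hKmem
  rw [proxValues, if_neg (by omega), if_pos hKk₂, sub_right_inj, div_left_inj' hρ.ne',
    sub_left_inj] at hval
  have hup := (nonneg_and_bounds_of_mem_uIcc hF.antitone hF.nonneg hK hKN hρ hs₀.1).2.1 K
    (Finset.mem_Icc.mpr ⟨hK, le_rfl⟩)
  rw [min_eq_left hup] at hval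
  rcases lt_or_ge (φ K) ((1 + ρ) * φ (K + 1)) with h | h
  · rw [max_eq_right (hs₀.mem_Ioo hF.antitone hK hKN hρ h).1.le] at hval
    rwa [← hval]
  · have hmem := (isOptimalS_iff_of_ge hF.antitone hKN hρ h).mp hs₀
    rw [max_eq_left hmem.2] at hval
    exact (isOptimalS_iff_of_ge hF.antitone hKN hρ h).mpr ⟨h.trans hval.le, hval.ge⟩

end ProximalPoint

end FixedRank

theorem mainTheorem5 (m n K : ℕ) (hK : 1 ≤ K) (hKN : K < min m n) (ρ : ℝ) (hρ : 0 < ρ)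
    (F : FixedRank.Mat m n) (U : FixedRank.Mat m (min m n)) (φ : ℕ → ℝ)
    (V : FixedRank.Mat n (min m n)) (hF : FixedRank.IsSVD F U φ V) :
    -- a minimizing `s` exists, and it is unique when the interval is nondegenerate
    (∃ s : ℝ, FixedRank.IsOptimalS (min m n) K ρ φ s) ∧
    (φ K < (1 + ρ) * φ (K + 1) → ∃! s : ℝ, FixedRank.IsOptimalS (min m n) K ρ φ s) ∧
    -- every minimizing `s`, with the stated `k₁` and `k₂`, gives the proximal point
    (∀ (s : ℝ) (k₁ k₂ : ℕ), FixedRank.IsOptimalS (min m n) K ρ φ s →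
      FixedRank.IsFirstBelow (min m n) φ s k₁ →
      FixedRank.IsLastAbove (min m n) φ (s / (1 + ρ)) k₂ →
        FixedRank.proxSolutions K ρ F =
          {FixedRank.assemble U (FixedRank.proxValues φ ρ s k₁ k₂) V} ∧
        (φ K < (1 + ρ) * φ (K + 1) →
          φ k₁ < s ∧ s / (1 + ρ) < φ k₂ ∧ FixedRank.IsProxParam K ρ F U φ V s k₁ k₂)) ∧
    -- conversely, any `s` that describes the proximal point is a minimizing one
    (∀ (s : ℝ) (k₁ k₂ : ℕ), FixedRank.IsProxParam K ρ F U φ V s k₁ k₂ →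
      FixedRank.IsOptimalS (min m n) K ρ φ s) := by
  refine ⟨FixedRank.exists_isOptimalS hF.antitone hK hKN hρ, fun h => ?_, ?_,
    fun s k₁ k₂ hp => hp.isOptimalS hF hK hKN hρ⟩
  · obtain ⟨s₀, hs₀, hs₀'⟩ := FixedRank.exists_sSlope_eq_zero hF.antitone hK hKN hρ h
    exact ⟨s₀, (FixedRank.isOptimalS_iff_of_lt hK hρ h hs₀ hs₀').mpr rfl,
      fun s hs => (FixedRank.isOptimalS_iff_of_lt hK hρ h hs₀ hs₀').mp hs⟩
  · intro s k₁ k₂ hs hk₁ hk₂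
    have hsol : FixedRank.proxSolutions K ρ F =
        {FixedRank.assemble U (FixedRank.proxValues φ ρ s k₁ k₂) V} := by
      rw [FixedRank.proxSolutions_eq_of_isOptimalS hF hK hKN hρ hs]
      congr 1
      exact FixedRank.assemble_congr U V fun j hj =>
        (FixedRank.proxValues_eq_sub_div hF.antitone hF.nonneg hρ hk₁ hk₂ hj).symm
    exact ⟨hsol, fun h => FixedRank.isProxParam_of_isOptimalS hF hK hKN hρ h hs hk₁ hk₂ hsol⟩
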